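/- Let $X$ be a universally complete (real) vector lattice, that is, every non-empty subset of $X$ that is bounded above has a supremum, and every non-empty set of pairwise disjoint positive elements of $X$ has a supremum. Then $X$ is unbounded order complete: every uo-Cauchy net in $X$ is uo-convergent to some element of $X$. Here a net $(x_\alpha)_{\alpha\in A}$ (indexed by a non-empty directed preordered set $A$) is order convergent to $x$, written $x_\alpha\xrightarrow{o}x$, if there is a net $(y_\gamma)_{\gamma\in\Gamma}$ in $X$ with $y_\gamma\downarrow 0$ such that for every $\gamma\in\Gamma$ there is $\alpha_0\in A$ with $|x_\alpha-x|\le y_\gamma$ for all $\alpha\ge\alpha_0$. The net is uo-convergent to $x$ if $|x_\alpha-x|\wedge u\xrightarrow{o}0$ for every $u\in X_+$. It is uo-Cauchy if the double net $(x_\alpha-x_\beta)_{(\alpha,\beta)\in A\times A}$ is uo-convergent to $0$. -/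

import Mathlib

universe u v w

/-- Order convergence of a net in a vector lattice: there is a net `y` with `y ↓ 0` such that every
`y γ` eventually dominates `|x α - l|`. The index set `Γ` of the dominating net is taken in the
universe of `X`; this loses nothing, see `OrderConvergesTo.of_dominating`. -/
def OrderConvergesTo {X : Type u} [AddCommGroup X] [Lattice X]
    {A : Type v} [Preorder A] (x : A → X) (l : X) : Prop :=
  ∃ (Γ : Type u) (_ : Preorder Γ) (_ : IsDirectedOrder Γ) (_ : Nonempty Γ) (y : Γ → X),
    Antitone y ∧ IsGLB (Set.range y) 0 ∧
      ∀ γ : Γ, ∃ α₀ : A, ∀ α : A, α₀ ≤ α → |x α - l| ≤ y γ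

/-- A dominating net indexed in any universe witnesses order convergence. -/
theorem OrderConvergesTo.of_dominating {X : Type u} [AddCommGroup X] [Lattice X]
    {A : Type v} [Preorder A] {x : A → X} {l : X}
    {Γ : Type w} [Preorder Γ] [IsDirectedOrder Γ] [Nonempty Γ] {y : Γ → X}
    (hy : Antitone y) (h0 : IsGLB (Set.range y) 0)
    (h : ∀ γ : Γ, ∃ α₀ : A, ∀ α : A, α₀ ≤ α → |x α - l| ≤ y γ) : OrderConvergesTo x l := by
  refine ⟨(Set.range y)ᵒᵈ, inferInstance, ⟨?_⟩, ?_, fun z => (OrderDual.ofDual z).1, ?_, ?_, ?_⟩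
  · rintro ⟨_, γ₁, rfl⟩ ⟨_, γ₂, rfl⟩
    obtain ⟨γ, h₁, h₂⟩ := exists_ge_ge γ₁ γ₂
    exact ⟨OrderDual.toDual ⟨y γ, γ, rfl⟩, hy h₁, hy h₂⟩
  · exact ⟨OrderDual.toDual ⟨_, Classical.arbitrary Γ, rfl⟩⟩
  · exact fun a b hab => hab
  · convert h0 using 1
    ext z
    constructor
    · rintro ⟨⟨_, γ, rfl⟩, rfl⟩
      exact ⟨γ, rfl⟩
    · rintro ⟨γ, rfl⟩
      exact ⟨OrderDual.toDual ⟨y γ, γ, rfl⟩, rfl⟩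
  · rintro ⟨_, γ, rfl⟩
    exact h γ

/-- Unbounded order (uo) convergence of a net. -/
def UOConvergesTo {X : Type u} [AddCommGroup X] [Lattice X]
    {A : Type v} [Preorder A] (x : A → X) (l : X) : Prop :=
  ∀ w : X, 0 ≤ w → OrderConvergesTo (fun α => |x α - l| ⊓ w) 0

/-- A net `x` is uo-Cauchy if the double net `x α - x β`, indexed by `A × A` with the product
order, is uo-convergent to `0`. -/
def UOCauchy {X : Type u} [AddCommGroup X] [Lattice X]
    {A : Type v} [Preorder A] (x : A → X) : Prop :=
  UOConvergesTo (fun p : A × A => x p.1 - x p.2) 0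

/-- Every uo-Cauchy net (with index set in `Type v`) is uo-convergent. -/
def UOComplete (X : Type u) [AddCommGroup X] [Lattice X] : Prop :=
  ∀ (A : Type v) [Preorder A] [IsDirectedOrder A] [Nonempty A] (x : A → X),
    UOCauchy x → ∃ l : X, UOConvergesTo x l

/-- Every non-empty subset that is bounded above has a supremum. -/
def DedekindComplete (X : Type u) [Lattice X] : Prop :=
  ∀ S : Set X, S.Nonempty → BddAbove S → ∃ a : X, IsLUB S a

/-- Every non-empty set of pairwise disjoint positive elements has a supremum. -/
def LaterallyComplete (X : Type u) [AddCommGroup X] [Lattice X] : Prop :=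
  ∀ S : Set X, S.Nonempty → (∀ a ∈ S, 0 ≤ a) → (∀ a ∈ S, ∀ b ∈ S, a ≠ b → a ⊓ b = 0) →
    ∃ a : X, IsLUB S a

/-- Universally complete: Dedekind complete and laterally complete. -/
def UniversallyComplete (X : Type u) [AddCommGroup X] [Lattice X] : Prop :=
  DedekindComplete X ∧ LaterallyComplete X

/-!
Order convergence of a positive net to zero says that the infimum of its eventual upper bounds is
zero. Splitting a uo-Cauchy net into its positive and negative parts, which are again uo-Cauchy, one
may assume that it is positive; it then converges to its lower limit `l = sup_γ inf_{β ≥ γ} x β`,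
because an eventual bound on `|x α - x β| ⊓ w` passes to infima and suprema in `x β`.

The point is that `l` exists, that is, that the tail infima are bounded above. If `w > 0` and
`|x α - x β| ⊓ w ≤ y` eventually, where `¬ w ≤ y`, then the tail infima are bounded on the band
generated by `(w - y)⁺`. Hence below every `w > 0` there is some `v > 0` on whose band they are
bounded. Lateral completeness glues the components of these bounds along a maximal disjoint system
of such `v`, and maximality makes the result a global upper bound.
-/

section EventualUpperBounds

open scoped Pointwise

/-- The eventual upper bounds of `u` along the filter `f`. Their infimum is the upper limit of `u`;
a positive net order converges to zero exactly when it is zero. -/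
def eventualUpperBounds {A : Type v} {X : Type u} [LE X] (f : Filter A) (u : A → X) : Set X :=
  {y | ∀ᶠ a in f, u a ≤ y}

variable {A : Type v} {X : Type u} {f : Filter A} {u₁ u₂ : A → X}

theorem eventualUpperBounds_subset_Ici [f.NeBot] [Preorder X] [Zero X] (h₁ : ∀ a, 0 ≤ u₁ a) :
    eventualUpperBounds f u₁ ⊆ Set.Ici 0 := fun _ hy =>
  let ⟨a, ha⟩ := Filter.Eventually.exists hy
  (h₁ a).trans ha

theorem isGLB_eventualUpperBounds_zero_of_le [f.NeBot] [Preorder X] [Zero X]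
    (h₁ : ∀ a, 0 ≤ u₁ a) (h : ∀ a, u₁ a ≤ u₂ a) (h₂ : IsGLB (eventualUpperBounds f u₂) 0) :
    IsGLB (eventualUpperBounds f u₁) 0 :=
  h₂.of_subset_of_superset isGLB_Ici (fun _ hy => hy.mono fun a ha => (h a).trans ha)
    (eventualUpperBounds_subset_Ici h₁)

theorem isGLB_eventualUpperBounds_zero_add [f.NeBot] [AddCommGroup X] [PartialOrder X]
    [IsOrderedAddMonoid X] (hnonneg₁ : ∀ a, 0 ≤ u₁ a) (hnonneg₂ : ∀ a, 0 ≤ u₂ a)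
    (h₁ : IsGLB (eventualUpperBounds f u₁) 0) (h₂ : IsGLB (eventualUpperBounds f u₂) 0) :
    IsGLB (eventualUpperBounds f (u₁ + u₂)) 0 := by
  have hadd : IsGLB (eventualUpperBounds f u₁ + eventualUpperBounds f u₂) 0 := by
    simpa only [add_zero] using h₁.add h₂
  refine hadd.of_subset_of_superset isGLB_Ici ?_
    (eventualUpperBounds_subset_Ici fun a => add_nonneg (hnonneg₁ a) (hnonneg₂ a))
  rintro _ ⟨y₁, hy₁, y₂, hy₂, rfl⟩
  exact hy₁.mp (hy₂.mono fun a ha₂ ha₁ => add_le_add ha₁ ha₂)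

end EventualUpperBounds

section LatticeOrderedGroup

variable {X : Type u} [AddCommGroup X] [Lattice X] [IsOrderedAddMonoid X]

theorem add_inf_le_inf_add_inf {a b c : X} (ha : 0 ≤ a) (hb : 0 ≤ b) (hc : 0 ≤ c) :
    (a + b) ⊓ c ≤ a ⊓ c + b ⊓ c := by
  rw [add_inf, inf_add, inf_add]
  refine le_inf (le_inf inf_le_left ?_) (le_inf ?_ ?_)
  · exact inf_le_right.trans (le_add_of_nonneg_right hb)
  · exact inf_le_right.trans (le_add_of_nonneg_left ha)
  · exact inf_le_right.trans (le_add_of_nonneg_left hc)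

theorem nsmul_inf_eq_zero {a b : X} (ha : 0 ≤ a) (hb : 0 ≤ b) (h : a ⊓ b = 0) (n : ℕ) :
    (n • a) ⊓ b = 0 := by
  refine le_antisymm ?_ (le_inf (nsmul_nonneg ha n) hb)
  induction n with
  | zero => simp only [zero_nsmul, inf_le_left]
  | succ n ih =>
    calc (n + 1) • a ⊓ b = (n • a + a) ⊓ b := by rw [succ_nsmul]
      _ ≤ n • a ⊓ b + a ⊓ b := add_inf_le_inf_add_inf (nsmul_nonneg ha n) ha hb
      _ ≤ 0 := by rwa [h, add_zero]

theorem posPart_sub_inf_posPart_sub_eq_zero (a b : X) : (a - b)⁺ ⊓ (b - a)⁺ = 0 := by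
  rw [← neg_sub a b, posPart_neg, posPart_inf_negPart_eq_zero]

theorem posPart_sub_inf_le_add (a b c : X) : (a - b ⊓ c)⁺ ≤ (a - b)⁺ + (a - c)⁺ := by
  have hb := posPart_nonneg (a - b)
  have hc := posPart_nonneg (a - c)
  rw [sub_inf]
  exact sup_le (sup_le (le_add_of_le_of_nonneg (le_posPart _) hc)
    (le_add_of_nonneg_of_le hb (le_posPart _))) (add_nonneg hb hc)

theorem posPart_sub_inf_posPart_sub_eq_zero_of_inf_le {a b c : X} (h : a ⊓ b ≤ c) :
    (b - c)⁺ ⊓ (a - b)⁺ = 0 := by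
  refine le_antisymm ?_ (le_inf (posPart_nonneg _) (posPart_nonneg _))
  have hle : (b - c)⁺ ≤ (b - a)⁺ := by
    refine sup_le ?_ (posPart_nonneg _)
    rw [sub_le_comm, ← inf_eq_sub_posPart_sub, inf_comm]
    exact h
  exact (inf_le_inf_right _ hle).trans (posPart_sub_inf_posPart_sub_eq_zero b a).le

theorem abs_posPart_sub_posPart_le (a b : X) : |a⁺ - b⁺| ≤ |a - b| :=
  abs_sup_sub_sup_le_abs a b 0

theorem abs_negPart_sub_negPart_le (a b : X) : |a⁻ - b⁻| ≤ |a - b| := by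
  rw [← posPart_neg, ← posPart_neg, abs_sub_comm a, ← neg_sub_neg a]
  exact abs_posPart_sub_posPart_le (-a) (-b)

theorem inf_le_of_isLUB {S : Set X} {s c y : X} (hs : IsLUB S s) (h : ∀ z ∈ S, z ⊓ c ≤ y) :
    s ⊓ c ≤ y := by
  have hle : s ≤ y + s ⊔ c - c := hs.2 fun z hz => by
    rw [le_sub_iff_add_le, ← inf_add_sup z c]
    exact add_le_add (h z hz) (sup_le_sup_right (hs.1 hz) c)
  rwa [le_sub_iff_add_le, ← inf_add_sup s c, add_le_add_iff_right] at hle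

theorem abs_sub_inf_le_of_isLUB {S : Set X} {s a w y : X} (hS : S.Nonempty) (hs : IsLUB S s)
    (h : ∀ z ∈ S, |a - z| ⊓ w ≤ y) : |a - s| ⊓ w ≤ y := by
  let _ : DistribLattice X := AddCommGroup.toDistribLattice X
  rw [abs, inf_sup_right, neg_sub]
  refine sup_le ?_ ?_
  · obtain ⟨z, hz⟩ := hS
    exact (inf_le_inf_right w ((sub_le_sub_left (hs.1 hz) a).trans (le_abs_self _))).trans (h z hz)
  · refine inf_le_of_isLUB ((OrderIso.subRight a).isLUB_image'.2 hs) ?_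
    rintro _ ⟨z, hz, rfl⟩
    refine (inf_le_inf_right w ?_).trans (h z hz)
    rw [abs_sub_comm]
    exact le_abs_self _

theorem abs_sub_inf_le_of_isGLB {S : Set X} {s a w y : X} (hS : S.Nonempty) (hs : IsGLB S s)
    (h : ∀ z ∈ S, |a - z| ⊓ w ≤ y) : |a - s| ⊓ w ≤ y := by
  rw [abs_sub_comm, ← neg_sub_neg]
  refine abs_sub_inf_le_of_isLUB hS.neg hs.neg fun z hz => ?_
  have habs : |-a - z| = |a - -z| := by rw [← abs_neg, neg_sub', neg_neg, sub_neg_eq_add]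
  rw [habs]
  exact h (-z) hz

theorem abs_sub_inf_le_of_isLUB_range_of_isGLB {A : Type v} [Preorder A] [IsDirectedOrder A]
    {x m : A → X} {l : X}
    (hm : ∀ γ, IsGLB (x '' Set.Ici γ) (m γ)) (hl : IsLUB (Set.range m) l) {α₀ : A} {a w y : X}
    (h : ∀ β, α₀ ≤ β → |a - x β| ⊓ w ≤ y) : |a - l| ⊓ w ≤ y := by
  have hmono : Monotone m := fun γ δ hγδ =>
    (hm δ).mono (hm γ) (Set.image_mono (Set.Ici_subset_Ici.2 hγδ))
  have htail : IsLUB (m '' Set.Ici α₀) l := by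
    refine ⟨fun _ hz => hl.1 (Set.image_subset_range _ _ hz), fun b hb => hl.2 ?_⟩
    rintro _ ⟨δ, rfl⟩
    obtain ⟨γ, hδγ, hγ⟩ := exists_ge_ge δ α₀
    exact (hmono hδγ).trans (hb ⟨γ, hγ, rfl⟩)
  refine abs_sub_inf_le_of_isLUB (Set.nonempty_Ici.image m) htail ?_
  rintro _ ⟨γ, hγ, rfl⟩
  refine abs_sub_inf_le_of_isGLB (Set.nonempty_Ici.image x) (hm γ) ?_
  rintro _ ⟨β, hβ, rfl⟩
  exact h β (le_trans hγ hβ)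

end LatticeOrderedGroup

section DedekindComplete

variable {X : Type u}

theorem DedekindComplete.exists_isGLB [Lattice X] (hX : DedekindComplete X) {S : Set X}
    (hne : S.Nonempty) (hS : BddBelow S) : ∃ a, IsGLB S a :=
  let ⟨a, ha⟩ := hX (lowerBounds S) hS hne.bddAbove_lowerBounds
  ⟨a, isLUB_lowerBounds.1 ha⟩

variable [AddCommGroup X] [Lattice X]

/-- `p` is the component of `b` in the band generated by the positive element `v`, described as the
supremum of the elements `b ⊓ k • v`. -/
def IsBandComponent (v b p : X) : Prop :=
  IsLUB (Set.range fun k : ℕ => b ⊓ k • v) p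

theorem DedekindComplete.exists_isBandComponent (hX : DedekindComplete X) (v b : X) :
    ∃ p, IsBandComponent v b p :=
  hX _ (Set.range_nonempty _) ⟨b, Set.forall_mem_range.2 fun _ => inf_le_left⟩

theorem IsBandComponent.nonneg {v b p : X} (hp : IsBandComponent v b p) (hb : 0 ≤ b) : 0 ≤ p :=
  (le_inf hb (zero_nsmul v).ge).trans (hp.1 ⟨0, rfl⟩)

variable [IsOrderedAddMonoid X]

theorem IsBandComponent.inf_eq_zero {v b p c : X} (hp : IsBandComponent v b p) (hv : 0 ≤ v)
    (hb : 0 ≤ b) (hc : 0 ≤ c) (hvc : v ⊓ c = 0) : p ⊓ c = 0 := by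
  refine le_antisymm (inf_le_of_isLUB hp ?_) (le_inf (hp.nonneg hb) hc)
  rintro _ ⟨k, rfl⟩
  exact (inf_le_inf_right c inf_le_right).trans (nsmul_inf_eq_zero hv hc hvc k).le

theorem DedekindComplete.nonpos_of_forall_nsmul_le (hX : DedekindComplete X) {z a : X}
    (h : ∀ n : ℕ, n • z ≤ a) : z ≤ 0 := by
  obtain ⟨s, hs⟩ := hX _ (Set.range_nonempty fun n : ℕ => n • z) ⟨a, Set.forall_mem_range.2 h⟩
  have hle : s ≤ s - z := hs.2 <| Set.forall_mem_range.2 fun n => by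
    rw [le_sub_iff_add_le, ← succ_nsmul]
    exact hs.1 ⟨n + 1, rfl⟩
  exact (le_sub_self_iff s).1 hle

theorem DedekindComplete.nonpos_of_forall_le_posPart_sub_nsmul (hX : DedekindComplete X) {z a : X}
    (ha : 0 ≤ a) (h : ∀ n : ℕ, z ≤ (a - n • z)⁺) : z ≤ 0 := by
  refine hX.nonpos_of_forall_nsmul_le (a := a) fun n => ?_
  induction n with
  | zero => rwa [zero_nsmul]
  | succ n ih =>
    have hz : z ≤ a - n • z := by simpa only [posPart_eq_self.2 (sub_nonneg.2 ih)] using h n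
    rwa [succ_nsmul, ← le_sub_iff_add_le']

theorem IsBandComponent.inf_posPart_sub_eq_zero (hX : DedekindComplete X) {v b p d : X}
    (hp : IsBandComponent v b p) (hv : 0 ≤ v) (hd : 0 ≤ d) (h : v ⊓ (d - b)⁺ = 0) :
    v ⊓ (d - p)⁺ = 0 := by
  refine le_antisymm (hX.nonpos_of_forall_le_posPart_sub_nsmul hd fun n => ?_)
    (le_inf hv (posPart_nonneg _))
  calc v ⊓ (d - p)⁺
      ≤ v ⊓ (d - b ⊓ n • v)⁺ :=
        inf_le_inf_left v (posPart_mono (sub_le_sub_left (hp.1 ⟨n, rfl⟩) d))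
    _ ≤ v ⊓ ((d - b)⁺ + (d - n • v)⁺) := inf_le_inf_left v (posPart_sub_inf_le_add d b (n • v))
    _ ≤ v ⊓ (d - b)⁺ + v ⊓ (d - n • v)⁺ := by
        simpa only [inf_comm v] using
          add_inf_le_inf_add_inf (posPart_nonneg (d - b)) (posPart_nonneg (d - n • v)) hv
    _ ≤ (d - n • v)⁺ := by
        rw [h, zero_add]
        exact inf_le_right
    _ ≤ (d - n • (v ⊓ (d - p)⁺))⁺ :=
        posPart_mono (sub_le_sub_left (nsmul_le_nsmul_right inf_le_left n) d)

end DedekindComplete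

section BoundedOnBands

theorem exists_maximal_pairwise_inf_eq_zero {X : Type u} [SemilatticeInf X] [Zero X] (P : Set X) :
    ∃ M ⊆ P, M.Pairwise (fun a b => a ⊓ b = 0) ∧
      ∀ w ∈ P, (∀ v ∈ M, w ⊓ v = 0) → w ∈ M := by
  obtain ⟨M, hM⟩ := zorn_subset {M : Set X | M ⊆ P ∧ M.Pairwise fun a b => a ⊓ b = 0}
    fun c hc hchain => ⟨⋃₀ c, ⟨Set.sUnion_subset fun s hs => (hc hs).1,
      (Set.pairwise_sUnion hchain.directedOn).2 fun s hs => (hc hs).2⟩,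
      fun _ => Set.subset_sUnion_of_mem⟩
  refine ⟨M, hM.prop.1, hM.prop.2, fun w hw hwM => ?_⟩
  have hins : (insert w M).Pairwise fun a b => a ⊓ b = 0 := hM.prop.2.insert fun v hv _ =>
    ⟨hwM v hv, by rw [inf_comm, hwM v hv]⟩
  exact hM.le_of_ge ⟨Set.insert_subset hw hM.prop.1, hins⟩ (Set.subset_insert w M)
    (Set.mem_insert w M)

variable {X : Type u} [AddCommGroup X] [Lattice X]

/-- Some positive `b` dominates `D` on the band generated by the positive element `v`: the excess
`(d - b)⁺` of every `d ∈ D` is disjoint from `v`. -/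
def BddAboveOnBand (v : X) (D : Set X) : Prop :=
  ∃ b : X, 0 ≤ b ∧ ∀ d ∈ D, v ⊓ (d - b)⁺ = 0

variable [IsOrderedAddMonoid X]

theorem UniversallyComplete.exists_forall_inf_posPart_sub_eq_zero (hX : UniversallyComplete X)
    {D M : Set X} (hD : ∀ d ∈ D, 0 ≤ d) (hM : ∀ v ∈ M, 0 ≤ v)
    (hdisj : M.Pairwise fun a b => a ⊓ b = 0) (hbdd : ∀ v ∈ M, BddAboveOnBand v D) :
    ∃ s : X, ∀ v ∈ M, ∀ d ∈ D, v ⊓ (d - s)⁺ = 0 := by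
  rcases M.eq_empty_or_nonempty with rfl | hne
  · exact ⟨0, fun v hv => hv.elim⟩
  choose! b hb hDb using hbdd
  choose p hp using fun v => hX.1.exists_isBandComponent v (b v)
  have hp0 : ∀ v ∈ M, 0 ≤ p v := fun v hv => (hp v).nonneg (hb v hv)
  have hpdisj : ∀ v ∈ M, ∀ w ∈ M, v ≠ w → p v ⊓ p w = 0 := fun v hv w hw hvw => by
    have hvw0 : v ⊓ p w = 0 := by
      rw [inf_comm]
      exact (hp w).inf_eq_zero (hM w hw) (hb w hw) (hM v hv) (hdisj hw hv hvw.symm)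
    exact (hp v).inf_eq_zero (hM v hv) (hb v hv) (hp0 w hw) hvw0
  obtain ⟨s, hs⟩ := hX.2 (p '' M) (hne.image p) (Set.forall_mem_image.2 hp0) <| by
    rintro _ ⟨v, hv, rfl⟩ _ ⟨w, hw, rfl⟩ hvw
    exact hpdisj v hv w hw (ne_of_apply_ne p hvw)
  refine ⟨s, fun v hv d hd => le_antisymm ?_ (le_inf (hM v hv) (posPart_nonneg _))⟩
  calc v ⊓ (d - s)⁺
      ≤ v ⊓ (d - p v)⁺ :=
        inf_le_inf_left v (posPart_mono (sub_le_sub_left (hs.1 ⟨v, hv, rfl⟩) d))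
    _ = 0 := (hp v).inf_posPart_sub_eq_zero hX.1 (hM v hv) (hD d hd) (hDb v hv d hd)

theorem UniversallyComplete.bddAbove_of_forall_exists_bddAboveOnBand (hX : UniversallyComplete X)
    {D : Set X} (hD : ∀ d ∈ D, 0 ≤ d)
    (h : ∀ w : X, 0 < w → ∃ v, 0 < v ∧ v ≤ w ∧ BddAboveOnBand v D) : BddAbove D := by
  obtain ⟨M, hMP, hdisj, hmax⟩ :=
    exists_maximal_pairwise_inf_eq_zero {v : X | 0 ≤ v ∧ BddAboveOnBand v D}
  obtain ⟨s, hs⟩ := hX.exists_forall_inf_posPart_sub_eq_zero hD (fun v hv => (hMP hv).1) hdisj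
    fun v hv => (hMP hv).2
  refine ⟨s, fun d hd => ?_⟩
  by_contra hds
  have hexcess : 0 < (d - s)⁺ :=
    (posPart_nonneg _).lt_of_ne' (by rwa [Ne, posPart_eq_zero, sub_nonpos])
  obtain ⟨w, hw0, hwle, hw⟩ := h _ hexcess
  have hwM : w ∈ M := hmax w ⟨hw0.le, hw⟩ fun v hv => by
    refine le_antisymm ?_ (le_inf hw0.le (hMP hv).1)
    rw [inf_comm]
    exact (inf_le_inf_left v hwle).trans (hs v hv d hd).le
  have hw_zero : w = 0 := by simpa only [inf_eq_left.2 hwle] using hs w hwM d hd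
  exact hw0.ne' hw_zero

end BoundedOnBands

section UnboundedOrderConvergence

instance instIsDirectedOrderProd {A : Type v} {B : Type w} [Preorder A] [Preorder B]
    [IsDirectedOrder A] [IsDirectedOrder B] : IsDirectedOrder (A × B) where
  directed p q :=
    let ⟨a, hpa, hqa⟩ := exists_ge_ge p.1 q.1
    let ⟨b, hpb, hqb⟩ := exists_ge_ge p.2 q.2
    ⟨(a, b), ⟨hpa, hpb⟩, ⟨hqa, hqb⟩⟩

variable {X : Type u} [AddCommGroup X] [Lattice X] [IsOrderedAddMonoid X]
  {A : Type v} [Preorder A] [IsDirectedOrder A] [Nonempty A] {x x' : A → X} {l l' : X}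

theorem orderConvergesTo_iff_isGLB :
    OrderConvergesTo x l ↔
      IsGLB (eventualUpperBounds Filter.atTop fun α => |x α - l|) 0 := by
  set S := eventualUpperBounds Filter.atTop fun α => |x α - l|
  constructor
  · rintro ⟨Γ, _, _, _, y, -, hy, h⟩
    refine hy.of_subset_of_superset isGLB_Ici ?_
      (eventualUpperBounds_subset_Ici fun α => abs_nonneg _)
    rintro _ ⟨γ, rfl⟩
    exact Filter.eventually_atTop.2 (h γ)
  · intro h0
    have hne : S.Nonempty := by
      by_contra! hempty
      have htop : IsTop (0 : X) := isGLB_empty_iff.1 (hempty ▸ h0)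
      exact hempty.subset (Filter.Eventually.of_forall fun α => htop _ : (0 : X) ∈ S)
    have : Nonempty Sᵒᵈ := hne.to_subtype
    have : IsDirectedOrder Sᵒᵈ := ⟨fun a b =>
      ⟨OrderDual.toDual ⟨a.ofDual.1 ⊓ b.ofDual.1,
        (a.ofDual.2.and b.ofDual.2).mono fun _ h => le_inf h.1 h.2⟩, inf_le_left, inf_le_right⟩⟩
    refine OrderConvergesTo.of_dominating (y := fun a : Sᵒᵈ => a.ofDual.1) (fun _ _ hab => hab) ?_
      fun a => Filter.eventually_atTop.1 a.ofDual.2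
    exact (Subtype.range_coe (s := S)).symm ▸ h0

theorem uoConvergesTo_iff_isGLB :
    UOConvergesTo x l ↔ ∀ w : X, 0 ≤ w →
      IsGLB (eventualUpperBounds Filter.atTop fun α => |x α - l| ⊓ w) 0 := by
  refine forall₂_congr fun w hw => ?_
  simp only [orderConvergesTo_iff_isGLB, sub_zero, abs_of_nonneg (le_inf (abs_nonneg _) hw)]

theorem uoCauchy_iff_isGLB :
    UOCauchy x ↔ ∀ w : X, 0 ≤ w →
      IsGLB (eventualUpperBounds Filter.atTop fun p : A × A => |x p.1 - x p.2| ⊓ w) 0 := by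
  simp only [UOCauchy, uoConvergesTo_iff_isGLB, sub_zero]

theorem UOConvergesTo.sub (hx : UOConvergesTo x l) (hx' : UOConvergesTo x' l') :
    UOConvergesTo (x - x') (l - l') := by
  rw [uoConvergesTo_iff_isGLB] at *
  intro w hw
  have hnonneg : ∀ a : X, 0 ≤ |a| ⊓ w := fun a => le_inf (abs_nonneg a) hw
  refine isGLB_eventualUpperBounds_zero_of_le (fun α => hnonneg _) (fun α => ?_)
    (isGLB_eventualUpperBounds_zero_add (fun α => hnonneg _) (fun α => hnonneg _)
      (hx w hw) (hx' w hw))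
  calc |(x - x') α - (l - l')| ⊓ w
      ≤ (|x α - l| + |x' α - l'|) ⊓ w := by
        rw [Pi.sub_apply, sub_sub_sub_comm, sub_eq_add_neg, ← abs_neg (x' α - l')]
        exact inf_le_inf_right w (abs_add_le _ _)
    _ ≤ |x α - l| ⊓ w + |x' α - l'| ⊓ w :=
        add_inf_le_inf_add_inf (abs_nonneg _) (abs_nonneg _) hw

theorem UOCauchy.of_abs_sub_le (hx : UOCauchy x) (h : ∀ α β, |x' α - x' β| ≤ |x α - x β|) :
    UOCauchy x' := by
  rw [uoCauchy_iff_isGLB] at *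
  exact fun w hw => isGLB_eventualUpperBounds_zero_of_le (fun p => le_inf (abs_nonneg _) hw)
    (fun p => inf_le_inf_right w (h p.1 p.2)) (hx w hw)

theorem UOCauchy.exists_bddAboveOnBand (hx : UOCauchy x) (hx0 : ∀ α, 0 ≤ x α) {m : A → X}
    (hm : ∀ γ β, γ ≤ β → m γ ≤ x β) {w : X} (hw : 0 < w) :
    ∃ v, 0 < v ∧ v ≤ w ∧ BddAboveOnBand v (Set.range m) := by
  have hglb := uoCauchy_iff_isGLB.1 hx w hw.le
  obtain ⟨y, hy, hwy⟩ : ∃ y ∈ eventualUpperBounds Filter.atTop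
      (fun p : A × A => |x p.1 - x p.2| ⊓ w), ¬ w ≤ y := by
    by_contra! hall
    exact hw.not_ge (hglb.2 hall)
  obtain ⟨α₀, hα₀⟩ := Filter.eventually_atTop_prod_self'.1 hy
  refine ⟨(w - y)⁺, (posPart_nonneg _).lt_of_ne' (by rwa [Ne, posPart_eq_zero, sub_nonpos]),
    sup_le (sub_le_self w (hglb.1 hy)) hw.le, x α₀ + w, add_nonneg (hx0 α₀) hw.le, ?_⟩
  rintro _ ⟨γ, rfl⟩
  obtain ⟨β, hγβ, hβ⟩ := exists_ge_ge γ α₀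
  have hle : (m γ - x α₀) ⊓ w ≤ y :=
    (inf_le_inf_right w ((sub_le_sub_right (hm γ β hγβ) _).trans (le_abs_self _))).trans
      (hα₀ β hβ α₀ le_rfl)
  rw [← sub_sub]
  exact posPart_sub_inf_posPart_sub_eq_zero_of_inf_le hle

theorem UOCauchy.exists_uoConvergesTo_of_nonneg (hX : UniversallyComplete X) (hx : UOCauchy x)
    (hx0 : ∀ α, 0 ≤ x α) : ∃ l, UOConvergesTo x l := by
  have htail0 : ∀ γ, 0 ∈ lowerBounds (x '' Set.Ici γ) := fun γ =>
    Set.forall_mem_image.2 fun β _ => hx0 β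
  choose m hm using fun γ => hX.1.exists_isGLB (Set.nonempty_Ici.image x) ⟨0, htail0 γ⟩
  have hbdd : BddAbove (Set.range m) := hX.bddAbove_of_forall_exists_bddAboveOnBand
    (Set.forall_mem_range.2 fun γ => (hm γ).2 (htail0 γ))
    fun w hw => hx.exists_bddAboveOnBand hx0 (fun γ β hγβ => (hm γ).1 ⟨β, hγβ, rfl⟩) hw
  obtain ⟨l, hl⟩ := hX.1 _ (Set.range_nonempty m) hbdd
  refine ⟨l, uoConvergesTo_iff_isGLB.2 fun w hw => ?_⟩
  refine (uoCauchy_iff_isGLB.1 hx w hw).of_subset_of_superset isGLB_Ici (fun y hy => ?_)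
    (eventualUpperBounds_subset_Ici fun α => le_inf (abs_nonneg _) hw)
  obtain ⟨α₀, hα₀⟩ := Filter.eventually_atTop_prod_self'.1 hy
  exact Filter.eventually_atTop.2
    ⟨α₀, fun α hα => abs_sub_inf_le_of_isLUB_range_of_isGLB hm hl (hα₀ α hα)⟩

end UnboundedOrderConvergence

theorem mainTheorem6_general (X : Type u) [AddCommGroup X] [Lattice X] [IsOrderedAddMonoid X]
    (hX : UniversallyComplete X) : UOComplete.{u, v} X := by
  intro A _ _ _ x hx
  obtain ⟨l₁, hl₁⟩ : ∃ l, UOConvergesTo (fun α => (x α)⁺) l :=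
    (hx.of_abs_sub_le fun _ _ => abs_posPart_sub_posPart_le _ _).exists_uoConvergesTo_of_nonneg hX
      fun _ => posPart_nonneg _
  obtain ⟨l₂, hl₂⟩ : ∃ l, UOConvergesTo (fun α => (x α)⁻) l :=
    (hx.of_abs_sub_le fun _ _ => abs_negPart_sub_negPart_le _ _).exists_uoConvergesTo_of_nonneg hX
      fun _ => negPart_nonneg _
  have hdecomp : (fun α => (x α)⁺) - (fun α => (x α)⁻) = x :=
    funext fun α => posPart_sub_negPart (x α)
  exact ⟨l₁ - l₂, hdecomp ▸ hl₁.sub hl₂⟩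

theorem mainTheorem6 (X : Type u) [AddCommGroup X] [Lattice X] [IsOrderedAddMonoid X]
    [Module ℝ X] [IsOrderedModule ℝ X] (hX : UniversallyComplete X) :
    UOComplete.{u, v} X :=
  mainTheorem6_general X hX
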